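/- Let $0\le r<N$ and $L\ge 1$ be integers and let $p_1,\dots,p_L\ge 0$, $\sum_i p_i=1$, be class priors. Let $\mathbf\Sigma_1,\dots,\mathbf\Sigma_L\in\mathbb R^{N\times N}$ be random positive semidefinite matrices of rank $r$ whose images $\mathcal R_i=\mathrm{Im}(\mathbf\Sigma_i)$ are independent random subspaces, each having a density with respect to the uniform probability measure on the Grassmann manifold of $r$-dimensional subspaces of $\mathbb R^N$. Let $\mathbf\Phi\in\mathbb R^{M\times N}$ be a random matrix, drawn independently of the $\mathbf\Sigma_i$, whose entries have a joint density and such that $\mathbf\Theta\mathbf\Phi$ has the same law as $\mathbf\Phi$ for every orthogonal $\mathbf\Theta\in\mathbb R^{M\times M}$. Given these matrices, the class $C\in\{1,\dots,L\}$ has law $(p_i)$, the source satisfies $\mathbf x\mid C=i\sim\mathcal N(\mathbf 0,\mathbf\Sigma_i)$, and one observes $\mathbf y=\mathbf\Phi\mathbf x+\mathbf n$ with independent noise $\mathbf n\sim\mathcal N(\mathbf 0,\sigma^2\mathbf I_M)$. Let $P_e=\sum_{i} p_i\,\mathbb P[\hat C\ne i\mid C=i]$ be the misclassification probability, for the given $\mathbf\Sigma_i$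 and $\mathbf\Phi$, of a MAP classifier $\hat C=\arg\max_i p(\mathbf y\mid C=i)\,p_i$, where $p(\mathbf y\mid C=i)$ is the density of $\mathcal N(\mathbf 0,\mathbf\Phi\mathbf\Sigma_i\mathbf\Phi^T+\sigma^2\mathbf I_M)$ and ties are broken in any measurable way. Put $R=2\min\{N-r,r\}$. Suppose that $d_0\in\mathbb R$ satisfies $d_0<R/4$ and that $$M=\lfloor 2d_0+r\rfloor+1 .$$ Then, for almost every realization of $\mathbf\Sigma_1,\dots,\mathbf\Sigma_L$, one has $\dim\mathcal R_i+\dim\mathcal R_j-2\dim(\mathcal R_i\cap\mathcal R_j)=R$ for all $i\ne j$, and, for almost every realization of $\mathbf\Phi$, for every choice of MAP classifiers, the limit below exists in $[-\infty,+\infty]$ and $$\lim_{\sigma^2\to0}\;-\frac{\log P_e}{\log(1/\sigma^2)}>d_0$$ (with the convention $\log 0=-\infty$). In particular $\lfloor 2d_0+r\rfloor+1$ is an upper bound on the minimum number of random measurements that guarantee this decay. -/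

import Mathlib

open MeasureTheory ProbabilityTheory Filter Topology
open scoped ENNReal

noncomputable section

namespace GaussClass

/-! ### The Grassmann manifold: Borel structure and uniform law -/

/-- The Borel structure on the linear subspaces of `ℝᴺ`: a subspace `V` is identified with its
orthogonal projection `P_V`, and the σ-algebra is generated by the maps `V ↦ P_V x`.  On the
subspaces of a fixed dimension `r` this is the Borel σ-algebra of the Grassmann manifold. -/
instance instMeasurableSpaceSubspaces (N : ℕ) :
    MeasurableSpace (Submodule ℝ (EuclideanSpace ℝ (Fin N))) :=
  MeasurableSpace.comap
    (fun V (x : EuclideanSpace ℝ (Fin N)) => V.starProjection x) inferInstance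

theorem measurable_subspace_iff {Ω : Type*} [MeasurableSpace Ω] {N : ℕ}
    {V : Ω → Submodule ℝ (EuclideanSpace ℝ (Fin N))} :
    Measurable V ↔ ∀ x, Measurable fun ω => (V ω).starProjection x := by
  rw [measurable_comap_iff, measurable_pi_iff]
  rfl

theorem norm_sq_starProjection {N : ℕ} (V : Submodule ℝ (EuclideanSpace ℝ (Fin N)))
    (x : EuclideanSpace ℝ (Fin N)) :
    ‖V.starProjection x‖ ^ 2 = ‖x‖ ^ 2 - Metric.infDist x V ^ 2 := by
  have h1 := Submodule.norm_sq_eq_add_norm_sq_starProjection x V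
  have h2 : Metric.infDist x V = ‖Vᗮ.starProjection x‖ := by
    rw [Submodule.starProjection_orthogonal_val, Submodule.starProjection_minimal,
      Metric.infDist_eq_iInf]
    simp [dist_eq_norm]
  rw [h2]; linarith

theorem measurable_span (N r : ℕ) :
    Measurable fun v : Fin r → EuclideanSpace ℝ (Fin N) =>
      Submodule.span ℝ (Set.range v) := by
  rw [measurable_subspace_iff]
  have hd : ∀ x : EuclideanSpace ℝ (Fin N), Measurable fun v : Fin r → EuclideanSpace ℝ (Fin N) =>
      Metric.infDist x (Submodule.span ℝ (Set.range v) : Set (EuclideanSpace ℝ (Fin N))) := by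
    intro x
    refine measurable_of_Iio fun a => IsOpen.measurableSet ?_
    have : (fun v : Fin r → EuclideanSpace ℝ (Fin N) =>
        Metric.infDist x (Submodule.span ℝ (Set.range v) : Set (EuclideanSpace ℝ (Fin N)))) ⁻¹'
          Set.Iio a = ⋃ c : Fin r → ℝ, {v | dist x (∑ i, c i • v i) < a} := by
      ext v
      simp only [Set.mem_preimage, Set.mem_Iio, Set.mem_iUnion, Set.mem_ofPred_eq]
      rw [Metric.infDist_lt_iff ⟨0, Submodule.zero_mem _⟩]
      constructor
      · rintro ⟨y, hy, h⟩
        obtain ⟨c, rfl⟩ := (Submodule.mem_span_range_iff_exists_fun ℝ).1 hy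
        exact ⟨c, h⟩
      · rintro ⟨c, h⟩
        exact ⟨_, (Submodule.mem_span_range_iff_exists_fun ℝ).2 ⟨c, rfl⟩, h⟩
    rw [this]
    refine isOpen_iUnion fun c => isOpen_lt (by fun_prop) continuous_const
  have hn : ∀ x : EuclideanSpace ℝ (Fin N), Measurable fun v : Fin r → EuclideanSpace ℝ (Fin N) =>
      ‖(Submodule.span ℝ (Set.range v)).starProjection x‖ ^ 2 := by
    intro x
    simp_rw [norm_sq_starProjection]
    exact measurable_const.sub ((hd x).pow_const 2)
  intro x
  have : (fun v : Fin r → EuclideanSpace ℝ (Fin N) =>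
      (Submodule.span ℝ (Set.range v)).starProjection x) = fun v => WithLp.toLp 2 fun k =>
      (‖(Submodule.span ℝ (Set.range v)).starProjection (x + EuclideanSpace.single k 1)‖ ^ 2
        - ‖(Submodule.span ℝ (Set.range v)).starProjection (x - EuclideanSpace.single k 1)‖ ^ 2)
        / 4 := by
    funext v
    ext k
    set V := Submodule.span ℝ (Set.range v)
    have key : inner ℝ (V.starProjection x) (V.starProjection (EuclideanSpace.single k 1))
        = (V.starProjection x) k := by
      rw [← Submodule.inner_starProjection_left_eq_right,
        Submodule.starProjection_eq_self_iff.2 (Submodule.starProjection_apply_mem V x)]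
      simp [EuclideanSpace.inner_single_right]
    simp only [map_add, map_sub]
    rw [← key, norm_add_sq_real, norm_sub_sq_real]
    ring
  rw [this]
  exact (WithLp.measurable_toLp 2 _).comp
    (measurable_pi_lambda _ fun k => ((hn _).sub (hn _)).div_const 4)

/-- The uniform (orthogonally invariant) probability law on the Grassmann manifold of
`r`-dimensional subspaces of `ℝᴺ`, `r ≤ N`: the law of the span of `r` independent standard
Gaussian vectors of `ℝᴺ`. -/
def grassmannUniform (N r : ℕ) : Measure (Submodule ℝ (EuclideanSpace ℝ (Fin N))) :=
  (Measure.pi fun _ : Fin r => stdGaussian (EuclideanSpace ℝ (Fin N))).map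
    fun v => Submodule.span ℝ (Set.range v)

instance isProbabilityMeasure_grassmannUniform (N r : ℕ) :
    IsProbabilityMeasure (grassmannUniform N r) :=
  Measure.isProbabilityMeasure_map (measurable_span N r).aemeasurable

/-! ### Source, measurements and classifier -/

/-- `Im S`, as a subspace of `ℝᴺ`. -/
def im {N : ℕ} (S : Matrix (Fin N) (Fin N) ℝ) : Submodule ℝ (EuclideanSpace ℝ (Fin N)) :=
  LinearMap.range (Matrix.toEuclideanLin S)

/-- `dim V + dim W - 2 dim (V ∩ W)`. -/
def dimGap {N : ℕ} (V W : Submodule ℝ (EuclideanSpace ℝ (Fin N))) : ℤ :=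
  (Module.finrank ℝ V : ℤ) + Module.finrank ℝ W - 2 * Module.finrank ℝ (V ⊓ W : Submodule ℝ _)

/-- The product (Borel) σ-algebra on real matrices. -/
instance instMeasurableSpaceMatrix (M N : ℕ) : MeasurableSpace (Matrix (Fin M) (Fin N) ℝ) :=
  inferInstanceAs (MeasurableSpace (Fin M → Fin N → ℝ))

/-- Lebesgue measure on the entries of `M × N` matrices. -/
def matrixVolume (M N : ℕ) : Measure (Matrix (Fin M) (Fin N) ℝ) :=
  Measure.pi fun _ : Fin M => Measure.pi fun _ : Fin N => (volume : Measure ℝ)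

/-- The random matrix `Φ` has a left rotation-invariant distribution: its entries have a joint
density, and `Θ Φ` has the same law as `Φ` for every orthogonal `Θ`. -/
structure LeftRotationInvariant {M N : ℕ} {Ω : Type*} [MeasurableSpace Ω] (Q : Measure Ω)
    (Φ : Ω → Matrix (Fin M) (Fin N) ℝ) : Prop where
  hasPDF : HasPDF Φ Q (matrixVolume M N)
  map_mul_left : ∀ Θ ∈ Matrix.orthogonalGroup (Fin M) ℝ,
    Q.map (fun ω => Θ * Φ ω) = Q.map Φ

/-- The law of `y = Φ x + n`, where `x ∼ 𝒩(0, S)` and `n ∼ 𝒩(0, s I)` are independent. -/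
def measurementLaw {M N : ℕ} (φ : Matrix (Fin M) (Fin N) ℝ) (S : Matrix (Fin N) (Fin N) ℝ)
    (s : ℝ) : Measure (EuclideanSpace ℝ (Fin M)) :=
  ((multivariateGaussian 0 S).prod
      (multivariateGaussian 0 (s • (1 : Matrix (Fin M) (Fin M) ℝ)))).map
    fun z => Matrix.toEuclideanLin φ z.1 + z.2

/-- The density of `𝒩(0, K)` on `ℝᴹ`, for positive definite `K`. -/
def gaussianDensity {M : ℕ} (K : Matrix (Fin M) (Fin M) ℝ) (y : EuclideanSpace ℝ (Fin M)) : ℝ :=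
  (Real.sqrt ((2 * Real.pi) ^ M * K.det))⁻¹ *
    Real.exp (-(y.ofLp ⬝ᵥ K⁻¹.mulVec y.ofLp) / 2)

/-- `p(y | C = i)`: zero-mean Gaussian density with covariance `Φ Σᵢ Φᵀ + s I`. -/
def condDensity {M N : ℕ} (φ : Matrix (Fin M) (Fin N) ℝ) (S : Matrix (Fin N) (Fin N) ℝ)
    (s : ℝ) (y : EuclideanSpace ℝ (Fin M)) : ℝ :=
  gaussianDensity (φ * S * φ.transpose + s • (1 : Matrix (Fin M) (Fin M) ℝ)) y

/-- `c` is a MAP classifier: `c y` maximizes `p(y | C = i) pᵢ` over `i` (ties are broken in any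
measurable way). -/
structure IsMAP {L M N : ℕ} (p : PMF (Fin L)) (S : Fin L → Matrix (Fin N) (Fin N) ℝ)
    (φ : Matrix (Fin M) (Fin N) ℝ) (s : ℝ) (c : EuclideanSpace ℝ (Fin M) → Fin L) : Prop where
  measurable : Measurable c
  le : ∀ y i, condDensity φ (S i) s y * (p i).toReal ≤
    condDensity φ (S (c y)) s y * (p (c y)).toReal

/-- The misclassification probability `∑ᵢ pᵢ ℙ[c(y) ≠ i | C = i]` of the classifier `c`. -/
def errorProb {L M N : ℕ} (p : PMF (Fin L)) (S : Fin L → Matrix (Fin N) (Fin N) ℝ)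
    (φ : Matrix (Fin M) (Fin N) ℝ) (s : ℝ) (c : EuclideanSpace ℝ (Fin M) → Fin L) : ℝ≥0∞ :=
  ∑ i, p i * measurementLaw φ (S i) s {y | c y ≠ i}

end GaussClass

end

namespace GaussClass

/-! ### Ranks of generic families of vectors -/

/-! For generic realizations the error probability is squeezed between two positive constants times
`s ^ (e / 2)`, where `s` is the noise variance and `e = (M - r)⁺`, so the limit equals `(M - r)⁺ /
2`. The choice of `M` says precisely that `M > 2 d₀ + r`, hence the limit exceeds `d₀`. If at most
one class has a nonzero prior, the error vanishes and the limit is `⊤`.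

The exponent comes from determinants. Write `Kᵢ = Φ Σᵢ Φᵀ + s I`. Generically `Φ Σᵢ Φᵀ` has rank
`min M r`, so `det Kᵢ` is of order `s ^ e` (`exists_det_add_smul_one_bounds`). Two generic images
span a space of dimension `min N (2r)`, and `d₀ < R / 4` forces `M ≤ min N (2r)`; thus `Φ (Σᵢ + Σⱼ)
Φᵀ` has full rank `M` and `det (Kᵢ + Kⱼ)` stays bounded away from `0` and `∞`.

The error is bounded above by the Bhattacharyya integrals `∫ √(fᵢ fⱼ)`, which are explicit in these
determinants, and below by a multiple of `∫ min fᵢ fⱼ` for one pair with positive priors. Both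
integrals are of order `s ^ (e / 2)`: `lintegral_sqrt_mul_gaussianDensity` and
`le_lintegral_min_gaussianDensity`.

Both genericity statements rest on `ae_min_le_finrank_span`, applied to Gaussian vectors spanning
the images and to the rows of `Φ`. -/

theorem isOpen_setOf_le_finrank_span {ι F : Type*} [Finite ι] [NormedAddCommGroup F]
    [NormedSpace ℝ F] (k : ℕ) :
    IsOpen {x : ι → F | k ≤ Module.finrank ℝ (Submodule.span ℝ (Set.range x))} := by
  -- The rank is at least `k` iff some subfamily of at least `k` vectors is independent, and
  -- independence is an open condition.
  have : {x : ι → F | k ≤ Module.finrank ℝ (Submodule.span ℝ (Set.range x))} =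
      ⋃ t ∈ {t : Set ι | k ≤ Nat.card t}, {x | LinearIndependent ℝ fun i : t => x i} := by
    ext x
    simp only [Set.mem_ofPred_eq, Set.mem_iUnion, exists_prop]
    constructor
    · intro h
      obtain ⟨κ, a, ha, hspan, hli⟩ := exists_linearIndependent' ℝ x
      have : Finite κ := Finite.of_injective a ha
      have := Fintype.ofFinite κ
      refine ⟨Set.range a, ?_, ?_⟩
      · rw [← hspan, finrank_span_eq_card hli] at h
        rwa [Nat.card_range_of_injective ha, Nat.card_eq_fintype_card]
      · exact (linearIndependent_equiv (Equiv.ofInjective a ha)).1 hli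
    · rintro ⟨t, ht, hli⟩
      have := Fintype.ofFinite t
      have := Fintype.ofFinite ι
      rw [Nat.card_eq_fintype_card] at ht
      rw [← finrank_span_eq_card hli] at ht
      have hfin : FiniteDimensional ℝ (Submodule.span ℝ (Set.range x)) :=
        FiniteDimensional.span_of_finite ℝ (Set.finite_range x)
      refine ht.trans (Submodule.finrank_mono (Submodule.span_mono ?_))
      rintro _ ⟨i, rfl⟩
      exact ⟨i, rfl⟩
  rw [this]
  refine isOpen_biUnion fun t _ => ?_
  have hc : Continuous fun x : ι → F => fun i : t => x i := by fun_prop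
  exact isOpen_setOfPred_linearIndependent.preimage hc

/-- As long as the span `W` of the images drawn so far is smaller than the range of `B`, its
preimage under `B` is a proper subspace, hence null, so a fresh vector almost surely raises the
dimension by one. -/
theorem ae_min_le_finrank_span {E F : Type*} [NormedAddCommGroup E] [NormedSpace ℝ E]
    [FiniteDimensional ℝ E] [MeasurableSpace E] [BorelSpace E]
    [NormedAddCommGroup F] [NormedSpace ℝ F] (μ : Measure E) [SigmaFinite μ]
    (hμ : ∀ V : Submodule ℝ E, V ≠ ⊤ → μ V = 0) (B : E →ₗ[ℝ] F) (n : ℕ) :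
    ∀ᵐ x ∂(Measure.pi fun _ : Fin n => μ),
      min n (Module.finrank ℝ (LinearMap.range B)) ≤
        Module.finrank ℝ (Submodule.span ℝ (Set.range fun i => B (x i))) := by
  have hB : Continuous B := B.continuous_of_finiteDimensional
  induction n with
  | zero => simp
  | succ n ih =>
    set t := Module.finrank ℝ (LinearMap.range B) with ht
    have hmeas : MeasurableSet {x : Fin (n + 1) → E | min (n + 1) t ≤
        Module.finrank ℝ (Submodule.span ℝ (Set.range fun i => B (x i)))} := by
      have hc : Continuous fun x : Fin (n + 1) → E => fun i => B (x i) := by fun_prop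
      exact ((isOpen_setOf_le_finrank_span (min (n + 1) t)).preimage hc).measurableSet
    have hmp := (measurePreserving_piFinSuccAbove (fun _ : Fin (n + 1) => μ) 0).symm
    have key : ∀ᵐ z ∂(μ.prod (Measure.pi fun _ : Fin n => μ)),
        (MeasurableEquiv.piFinSuccAbove (fun _ : Fin (n + 1) => E) 0).symm z ∈
          {x : Fin (n + 1) → E | min (n + 1) t ≤
            Module.finrank ℝ (Submodule.span ℝ (Set.range fun i => B (x i)))} := by
      have hm2 := (MeasurableEquiv.piFinSuccAbove (fun _ : Fin (n + 1) => E) 0).symm.measurable hmeas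
      -- Fubini in the swapped order: the first `n` vectors are frozen and the new one varies. The
      -- openness of the rank condition supplies the measurability.
      rw [Measure.ae_prod_iff_ae_ae hm2, Measure.ae_ae_comm
        (p := fun a x => (MeasurableEquiv.piFinSuccAbove (fun _ : Fin (n + 1) => E) 0).symm (a, x) ∈
          {x : Fin (n + 1) → E | min (n + 1) t ≤
            Module.finrank ℝ (Submodule.span ℝ (Set.range fun i => B (x i)))}) hm2]
      filter_upwards [ih] with x hx
      set W := Submodule.span ℝ (Set.range fun i => B (x i)) with hW
      have hfinR : FiniteDimensional ℝ (LinearMap.range B) := inferInstance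
      have hWR : W ≤ LinearMap.range B := by
        rw [hW, Submodule.span_le]; rintro _ ⟨i, rfl⟩; exact ⟨_, rfl⟩
      have hfinW : FiniteDimensional ℝ W := Submodule.finiteDimensional_of_le hWR
      have hrange : ∀ a : E, Submodule.span ℝ (Set.range fun i =>
          B ((MeasurableEquiv.piFinSuccAbove (fun _ : Fin (n + 1) => E) 0).symm (a, x) i)) =
          Submodule.span ℝ {B a} ⊔ W := by
        intro a
        rw [hW, ← Submodule.span_union]
        congr 1
        ext y
        simp only [Set.mem_range, Fin.exists_fin_succ]
        simp [MeasurableEquiv.piFinSuccAbove, Fin.insertNthEquiv, eq_comm]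
      by_cases hle : t ≤ Module.finrank ℝ W
      · refine Eventually.of_forall fun a => ?_
        change min (n + 1) t ≤ Module.finrank ℝ (Submodule.span ℝ (Set.range fun i =>
          B ((MeasurableEquiv.piFinSuccAbove (fun _ : Fin (n + 1) => E) 0).symm (a, x) i)))
        rw [hrange]
        have : FiniteDimensional ℝ (Submodule.span ℝ {B a} ⊔ W : Submodule ℝ F) := inferInstance
        exact (min_le_right _ _).trans (hle.trans (Submodule.finrank_mono le_sup_right))
      · push Not at hle
        have hne : W.comap B ≠ ⊤ := by
          intro h
          have : LinearMap.range B ≤ W := by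
            rintro _ ⟨a, rfl⟩
            have : a ∈ W.comap B := h ▸ Submodule.mem_top
            exact this
          have := Submodule.finrank_mono this
          omega
        have h0 := hμ _ hne
        have : ∀ᵐ a ∂μ, a ∉ (W.comap B : Set E) := measure_eq_zero_iff_ae_notMem.1 h0
        filter_upwards [this] with a ha
        change min (n + 1) t ≤ Module.finrank ℝ (Submodule.span ℝ (Set.range fun i =>
          B ((MeasurableEquiv.piFinSuccAbove (fun _ : Fin (n + 1) => E) 0).symm (a, x) i)))
        rw [hrange]
        have hlt : W < Submodule.span ℝ {B a} ⊔ W := by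
          refine lt_of_le_of_ne le_sup_right fun h => ha ?_
          have : B a ∈ Submodule.span ℝ {B a} ⊔ W :=
            Submodule.mem_sup_left (Submodule.mem_span_singleton_self _)
          rw [← h] at this
          exact this
        have := Submodule.finrank_lt_finrank_of_lt hlt
        omega
    have := hmp.symm.quasiMeasurePreserving.ae key
    filter_upwards [this] with x hx
    rwa [MeasurableEquiv.apply_symm_apply] at hx

/-! ### Densities of Gaussian laws -/

theorem measurable_gaussianDensity {M : ℕ} (K : Matrix (Fin M) (Fin M) ℝ) :
    Measurable (gaussianDensity K) := by
  unfold gaussianDensity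
  have : Continuous fun y : EuclideanSpace ℝ (Fin M) => y.ofLp ⬝ᵥ K⁻¹.mulVec y.ofLp := by
    fun_prop
  fun_prop

theorem dotProduct_self_eq_norm_sq {M : ℕ} (y : EuclideanSpace ℝ (Fin M)) :
    y.ofLp ⬝ᵥ y.ofLp = ‖y‖ ^ 2 := by
  rw [EuclideanSpace.real_norm_sq_eq]
  simp [dotProduct, sq]

theorem gaussianDensity_one {M : ℕ} (y : EuclideanSpace ℝ (Fin M)) :
    gaussianDensity 1 y = (Real.sqrt ((2 * Real.pi) ^ M))⁻¹ * Real.exp (-(1 / 2) * ‖y‖ ^ 2) := by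
  rw [gaussianDensity]
  simp only [Matrix.det_one, mul_one, inv_one, Matrix.one_mulVec, dotProduct_self_eq_norm_sq]
  congr 2
  ring

theorem gaussianDensity_nonneg {M : ℕ} (K : Matrix (Fin M) (Fin M) ℝ)
    (y : EuclideanSpace ℝ (Fin M)) : 0 ≤ gaussianDensity K y := by
  unfold gaussianDensity; positivity

theorem integrable_exp_neg_norm_sq (M : ℕ) :
    Integrable fun y : EuclideanSpace ℝ (Fin M) => Real.exp (-(1 / 2) * ‖y‖ ^ 2) := by
  have h := GaussianFourier.integrable_cexp_neg_mul_sq_norm_add (V := EuclideanSpace ℝ (Fin M))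
    (b := 1 / 2) (by norm_num) 0 0
  have := h.re
  refine this.congr (Eventually.of_forall fun y => ?_)
  simp only [zero_mul, add_zero]
  rw [show (-(1 / 2 : ℂ) * (‖y‖ : ℂ) ^ 2) = ((-(1 / 2) * ‖y‖ ^ 2 : ℝ) : ℂ) by push_cast; ring,
    ← Complex.ofReal_exp]
  exact Complex.ofReal_re _

theorem stdGaussian_eq_withDensity (M : ℕ) :
    stdGaussian (EuclideanSpace ℝ (Fin M)) =
      volume.withDensity fun y => ENNReal.ofReal (gaussianDensity 1 y) := by
  have hint : Integrable fun y : EuclideanSpace ℝ (Fin M) => gaussianDensity 1 y := by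
    simp_rw [gaussianDensity_one]
    exact (integrable_exp_neg_norm_sq M).const_mul _
  have : IsFiniteMeasure (volume.withDensity fun y : EuclideanSpace ℝ (Fin M) =>
      ENNReal.ofReal (gaussianDensity 1 y)) :=
    isFiniteMeasure_withDensity_ofReal hint.2
  apply Measure.ext_of_charFun
  ext t
  rw [charFun_stdGaussian, charFun_apply,
    integral_withDensity_eq_integral_toReal_smul (measurable_gaussianDensity _).ennreal_ofReal
      (by simp)]
  have h := GaussianFourier.integral_cexp_neg_mul_sq_norm_add (V := EuclideanSpace ℝ (Fin M))
    (b := 1 / 2) (by norm_num) Complex.I t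
  have hpi : (0 : ℝ) < 2 * Real.pi := by positivity
  have e : ∀ y : EuclideanSpace ℝ (Fin M),
      (ENNReal.ofReal (gaussianDensity 1 y)).toReal • Complex.exp (inner ℝ y t * Complex.I) =
      (((Real.sqrt ((2 * Real.pi) ^ M))⁻¹ : ℝ) : ℂ) *
        Complex.exp (-(1 / 2) * ‖y‖ ^ 2 + Complex.I * inner ℝ t y) := by
    intro y
    rw [ENNReal.toReal_ofReal (gaussianDensity_nonneg _ _), gaussianDensity_one,
      Complex.real_smul, Complex.exp_add, real_inner_comm]
    push_cast
    rw [mul_comm Complex.I]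
    ring
  simp_rw [e]
  rw [integral_const_mul, h]
  have h2 : ((Real.pi : ℂ) / (1 / 2)) ^ ((Module.finrank ℝ (EuclideanSpace ℝ (Fin M)) : ℂ) / 2) =
      ((Real.sqrt ((2 * Real.pi) ^ M) : ℝ) : ℂ) := by
    rw [finrank_euclideanSpace_fin, Real.sqrt_eq_rpow, ← Real.rpow_natCast_mul hpi.le,
      Complex.ofReal_cpow hpi.le]
    push_cast
    congr 1
    · ring
    · ring
  rw [h2, ← mul_assoc, ← Complex.ofReal_mul, inv_mul_cancel₀ (by positivity)]
  simp only [Complex.ofReal_one, one_mul, Complex.I_sq]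
  congr 1
  ring

theorem stdGaussian_submodule_eq_zero {N : ℕ} (V : Submodule ℝ (EuclideanSpace ℝ (Fin N)))
    (hV : V ≠ ⊤) : stdGaussian (EuclideanSpace ℝ (Fin N)) V = 0 := by
  rw [stdGaussian_eq_withDensity]
  exact withDensity_absolutelyContinuous _ _ (Measure.addHaar_submodule _ V hV)

open scoped MatrixOrder in
-- The law is the image of the standard Gaussian under `√K`; the density follows by linear change of
-- variables with Jacobian `|det √K|`.
theorem multivariateGaussian_eq_withDensity {M : ℕ} {K : Matrix (Fin M) (Fin M) ℝ}
    (hK : K.PosDef) :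
    multivariateGaussian 0 K =
      volume.withDensity fun y => ENNReal.ofReal (gaussianDensity K y) := by
  set R := CFC.sqrt K with hR
  have hRR : R * R = K := CFC.sqrt_mul_sqrt_self K hK.posSemidef.nonneg
  have hRherm : R.transpose = R := by
    have := (CFC.sqrt_nonneg K).isSelfAdjoint
    rw [← Matrix.conjTranspose_eq_transpose_of_trivial]
    exact this
  have hdet : R.det * R.det = K.det := by rw [← Matrix.det_mul, hRR]
  have hdet0 : R.det ≠ 0 := by
    intro h
    have := hK.det_pos
    rw [← hdet, h] at this
    simp at this
  have hunit : IsUnit R.det := isUnit_iff_ne_zero.2 hdet0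
  set T : EuclideanSpace ℝ (Fin M) →ₗ[ℝ] EuclideanSpace ℝ (Fin M) := Matrix.toEuclideanLin R
  have hTdet : LinearMap.det T = R.det := by
    simp only [T]
    rw [Matrix.toEuclideanLin_eq_toLin_orthonormal, LinearMap.det_toLin]
  have hTcont : Continuous T := T.continuous_of_finiteDimensional
  have hT : ∀ x, T x = Matrix.toEuclideanCLM (𝕜 := ℝ) R x := fun x => rfl
  have hquad : ∀ x, (T x).ofLp ⬝ᵥ K⁻¹.mulVec (T x).ofLp = ‖x‖ ^ 2 := by
    intro x
    have : (T x).ofLp = R.mulVec x.ofLp := rfl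
    rw [this, Matrix.mulVec_mulVec, Matrix.dotProduct_mulVec, Matrix.vecMul_mulVec, hRherm,
      ← hRR, Matrix.mul_inv_rev, Matrix.nonsing_inv_mul_cancel_right _ _ hunit,
      Matrix.mul_nonsing_inv _ hunit, Matrix.vecMul_one, dotProduct_self_eq_norm_sq]
  have hdens : ∀ x, ENNReal.ofReal (gaussianDensity 1 x) =
      ENNReal.ofReal |R.det| * ENNReal.ofReal (gaussianDensity K (T x)) := by
    intro x
    rw [← ENNReal.ofReal_mul (abs_nonneg _)]
    congr 1
    rw [gaussianDensity_one, gaussianDensity, hquad, ← hdet, Real.sqrt_mul (by positivity),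
      Real.sqrt_mul_self_eq_abs]
    have : |R.det| ≠ 0 := abs_ne_zero.2 hdet0
    field_simp
  have hvol : (volume : Measure (EuclideanSpace ℝ (Fin M))) =
      ENNReal.ofReal |R.det| • (volume : Measure (EuclideanSpace ℝ (Fin M))).map T := by
    rw [Measure.map_linearMap_addHaar_eq_smul_addHaar _ (hTdet ▸ hdet0), hTdet, smul_smul,
      ← ENNReal.ofReal_mul (abs_nonneg _), ← abs_mul, mul_inv_cancel₀ hdet0]
    simp
  rw [multivariateGaussian, stdGaussian_eq_withDensity]
  simp only [zero_add, ← hR, ← hT]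
  ext A hA
  have hm := (measurable_gaussianDensity K).ennreal_ofReal
  rw [Measure.map_apply hTcont.measurable hA, withDensity_apply _ (hTcont.measurable hA),
    withDensity_apply _ hA]
  conv_rhs => rw [hvol]
  rw [Measure.restrict_smul, lintegral_smul_measure, setLIntegral_map hA hm hTcont.measurable]
  simp_rw [hdens]
  rw [lintegral_const_mul' _ _ ENNReal.ofReal_ne_top]
  rfl

theorem lintegral_gaussianDensity {M : ℕ} {K : Matrix (Fin M) (Fin M) ℝ} (hK : K.PosDef) :
    ∫⁻ y, ENNReal.ofReal (gaussianDensity K y) = 1 := by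
  have h : multivariateGaussian 0 K Set.univ = 1 := measure_univ
  rwa [multivariateGaussian_eq_withDensity hK, withDensity_apply _ MeasurableSet.univ,
    Measure.restrict_univ] at h

theorem lintegral_exp_neg_quadratic {M : ℕ} {Q : Matrix (Fin M) (Fin M) ℝ} (hQ : Q.PosDef) :
    ∫⁻ y : EuclideanSpace ℝ (Fin M),
        ENNReal.ofReal (Real.exp (-(y.ofLp ⬝ᵥ Q.mulVec y.ofLp) / 2)) =
      ENNReal.ofReal (Real.sqrt ((2 * Real.pi) ^ M / Q.det)) := by
  have h := lintegral_gaussianDensity hQ.inv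
  have hdet := hQ.det_pos
  have hc : 0 < Real.sqrt ((2 * Real.pi) ^ M / Q.det) := by positivity
  have e : ∀ y, ENNReal.ofReal (gaussianDensity Q⁻¹ y) =
      ENNReal.ofReal (Real.sqrt ((2 * Real.pi) ^ M / Q.det))⁻¹ *
        ENNReal.ofReal (Real.exp (-(y.ofLp ⬝ᵥ Q.mulVec y.ofLp) / 2)) := by
    intro y
    rw [← ENNReal.ofReal_mul (by positivity), gaussianDensity,
      Matrix.nonsing_inv_nonsing_inv _ (isUnit_iff_ne_zero.2 hdet.ne'), Matrix.det_nonsing_inv,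
      Ring.inverse_eq_inv', div_eq_mul_inv ((2 * Real.pi) ^ M)]
  simp_rw [e] at h
  rw [lintegral_const_mul' _ _ ENNReal.ofReal_ne_top, ENNReal.ofReal_inv_of_pos hc] at h
  have hne : ENNReal.ofReal (Real.sqrt ((2 * Real.pi) ^ M / Q.det)) ≠ 0 := by simpa using hc
  calc _ = ENNReal.ofReal (Real.sqrt ((2 * Real.pi) ^ M / Q.det)) *
        ((ENNReal.ofReal (Real.sqrt ((2 * Real.pi) ^ M / Q.det)))⁻¹ * _) := by
        rw [← mul_assoc, ENNReal.mul_inv_cancel hne ENNReal.ofReal_ne_top, one_mul]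
    _ = _ := by rw [h, mul_one]

/-! ### The law of the measurements -/

theorem posSemidef_compress {M N : ℕ} (φ : Matrix (Fin M) (Fin N) ℝ)
    {S : Matrix (Fin N) (Fin N) ℝ} (hS : S.PosSemidef) :
    (φ * S * φ.transpose).PosSemidef := by
  rw [← Matrix.conjTranspose_eq_transpose_of_trivial]
  exact hS.mul_mul_conjTranspose_same φ

theorem posDef_add_smul_one {M : ℕ} {A : Matrix (Fin M) (Fin M) ℝ} (hA : A.PosSemidef) {s : ℝ}
    (hs : 0 < s) : (A + s • (1 : Matrix (Fin M) (Fin M) ℝ)).PosDef :=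
  Matrix.PosDef.posSemidef_add hA (Matrix.PosDef.one.smul hs)

/-- The law of `y` is the convolution of the image of `𝒩(0, S)` under `φ` with the noise;
characteristic functions multiply and the quadratic forms in the exponents add. -/
theorem measurementLaw_eq_multivariateGaussian {M N : ℕ} (φ : Matrix (Fin M) (Fin N) ℝ)
    {S : Matrix (Fin N) (Fin N) ℝ} (hS : S.PosSemidef) {s : ℝ} (hs : 0 < s) :
    measurementLaw φ S s =
      multivariateGaussian 0 (φ * S * φ.transpose + s • (1 : Matrix (Fin M) (Fin M) ℝ)) := by
  have hφ : Continuous (Matrix.toEuclideanLin φ) :=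
    LinearMap.continuous_of_finiteDimensional _
  have hN : (s • (1 : Matrix (Fin M) (Fin M) ℝ)).PosSemidef :=
    (Matrix.PosDef.one.smul hs).posSemidef
  have hconv : measurementLaw φ S s =
      ((multivariateGaussian 0 S).map (Matrix.toEuclideanLin φ)).conv
        (multivariateGaussian 0 (s • (1 : Matrix (Fin M) (Fin M) ℝ))) := by
    rw [measurementLaw, Measure.conv]
    nth_rw 2 [← Measure.map_id (μ := multivariateGaussian 0 (s • (1 : Matrix (Fin M) (Fin M) ℝ)))]
    rw [Measure.map_prod_map _ _ hφ.measurable measurable_id,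
      Measure.map_map (by fun_prop) (hφ.measurable.prodMap measurable_id)]
    rfl
  have : IsProbabilityMeasure ((multivariateGaussian 0 S).map (Matrix.toEuclideanLin φ)) :=
    Measure.isProbabilityMeasure_map hφ.aemeasurable
  have : IsProbabilityMeasure (measurementLaw φ S s) := by rw [hconv]; infer_instance
  apply Measure.ext_of_charFun
  ext t
  have hmap : charFun ((multivariateGaussian 0 S).map (Matrix.toEuclideanLin φ)) t =
      charFun (multivariateGaussian 0 S) (Matrix.toEuclideanLin φ.transpose t) := by
    rw [charFun_apply, integral_map hφ.aemeasurable (by fun_prop), charFun_apply]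
    congr 1
    ext x
    congr 3
    simp [EuclideanSpace.inner_eq_star_dotProduct, Matrix.dotProduct_mulVec,
      Matrix.mulVec_transpose, dotProduct_comm]
  rw [hconv, charFun_conv, hmap, charFun_multivariateGaussian hS, charFun_multivariateGaussian hN,
    charFun_multivariateGaussian (posDef_add_smul_one (posSemidef_compress φ hS) hs).posSemidef,
    ← Complex.exp_add]
  congr 1
  have : (t.ofLp ⬝ᵥ (φ * S * φ.transpose + s • (1 : Matrix (Fin M) (Fin M) ℝ)).mulVec t.ofLp) =
      ((Matrix.toEuclideanLin φ.transpose t).ofLp ⬝ᵥ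
        S.mulVec (Matrix.toEuclideanLin φ.transpose t).ofLp) +
      t.ofLp ⬝ᵥ (s • (1 : Matrix (Fin M) (Fin M) ℝ)).mulVec t.ofLp := by
    have e : (Matrix.toEuclideanLin φ.transpose t).ofLp = φ.transpose.mulVec t.ofLp := rfl
    rw [Matrix.add_mulVec, dotProduct_add, e, ← Matrix.mulVec_mulVec, ← Matrix.mulVec_mulVec,
      Matrix.dotProduct_mulVec, ← Matrix.mulVec_transpose]
  rw [this]
  push_cast
  simp
  ring

theorem measurementLaw_apply {M N : ℕ} (φ : Matrix (Fin M) (Fin N) ℝ)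
    {S : Matrix (Fin N) (Fin N) ℝ} (hS : S.PosSemidef) {s : ℝ} (hs : 0 < s)
    {A : Set (EuclideanSpace ℝ (Fin M))} (hA : MeasurableSet A) :
    measurementLaw φ S s A = ∫⁻ y in A, ENNReal.ofReal (condDensity φ S s y) := by
  rw [measurementLaw_eq_multivariateGaussian φ hS hs, multivariateGaussian_eq_withDensity
    (posDef_add_smul_one (posSemidef_compress φ hS) hs), withDensity_apply _ hA]
  rfl

/-! ### Generic subspaces -/

theorem span_range_starProjection {N : ℕ} (V : Submodule ℝ (EuclideanSpace ℝ (Fin N))) :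
    Submodule.span ℝ (Set.range fun a => V.starProjection (EuclideanSpace.basisFun (Fin N) ℝ a)) =
      V := by
  have h : (Set.range fun a => V.starProjection (EuclideanSpace.basisFun (Fin N) ℝ a)) =
      (V.starProjection : EuclideanSpace ℝ (Fin N) →ₗ[ℝ] EuclideanSpace ℝ (Fin N)) ''
        Set.range (EuclideanSpace.basisFun (Fin N) ℝ) := by
    rw [← Set.range_comp]; rfl
  rw [h, ← Submodule.map_span, ← OrthonormalBasis.coe_toBasis, Module.Basis.span_eq,
    Submodule.map_top]
  exact Submodule.range_starProjection V

/-- The sum of two subspaces is spanned by the projections of the basis vectors, which depend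
measurably on the subspaces, so the set is a preimage of an open rank condition. -/
theorem measurableSet_le_finrank_sup {N : ℕ} (k : ℕ) :
    MeasurableSet {q : Submodule ℝ (EuclideanSpace ℝ (Fin N)) ×
      Submodule ℝ (EuclideanSpace ℝ (Fin N)) |
        k ≤ Module.finrank ℝ (q.1 ⊔ q.2 : Submodule ℝ (EuclideanSpace ℝ (Fin N)))} := by
  let g : Submodule ℝ (EuclideanSpace ℝ (Fin N)) × Submodule ℝ (EuclideanSpace ℝ (Fin N)) →
      Fin N ⊕ Fin N → EuclideanSpace ℝ (Fin N) := fun q => Sum.elim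
    (fun a => q.1.starProjection (EuclideanSpace.basisFun (Fin N) ℝ a))
    (fun a => q.2.starProjection (EuclideanSpace.basisFun (Fin N) ℝ a))
  have hg : Measurable g := by
    refine measurable_pi_lambda _ ?_
    rintro (a | a)
    · exact (measurable_subspace_iff.1 measurable_fst) _
    · exact (measurable_subspace_iff.1 measurable_snd) _
  have hspan : ∀ q, Submodule.span ℝ (Set.range (g q)) = q.1 ⊔ q.2 := by
    intro q
    rw [Set.Sum.elim_range, Submodule.span_union, span_range_starProjection,
      span_range_starProjection]
  have := (isOpen_setOf_le_finrank_span (ι := Fin N ⊕ Fin N)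
    (F := EuclideanSpace ℝ (Fin N)) k).measurableSet.preimage hg
  convert this using 1
  ext q
  change _ ↔ k ≤ Module.finrank ℝ (Submodule.span ℝ (Set.range (g q)))
  rw [hspan q]
  rfl

/-- The projection of `V` to `Wᗮ` lies in `V ⊔ W` and meets `W` only in `0`. -/
theorem add_finrank_map_starProjection_le {N : ℕ}
    (V W : Submodule ℝ (EuclideanSpace ℝ (Fin N))) :
    Module.finrank ℝ W + Module.finrank ℝ (V.map (Wᗮ.starProjection :
      EuclideanSpace ℝ (Fin N) →ₗ[ℝ] EuclideanSpace ℝ (Fin N))) ≤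
      Module.finrank ℝ (V ⊔ W : Submodule ℝ (EuclideanSpace ℝ (Fin N))) := by
  set V' := V.map (Wᗮ.starProjection :
      EuclideanSpace ℝ (Fin N) →ₗ[ℝ] EuclideanSpace ℝ (Fin N)) with hV'
  have hinf : W ⊓ V' = ⊥ := by
    refine le_bot_iff.1 ((inf_le_inf_left W ?_).trans_eq (Submodule.inf_orthogonal_eq_bot W))
    rintro _ ⟨x, -, rfl⟩
    exact Submodule.starProjection_apply_mem _ x
  have hle : W ⊔ V' ≤ V ⊔ W := by
    refine sup_le le_sup_right ?_
    rintro _ ⟨x, hx, rfl⟩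
    have e : (Wᗮ.starProjection : EuclideanSpace ℝ (Fin N) →ₗ[ℝ] EuclideanSpace ℝ (Fin N)) x =
        x - W.starProjection x := Submodule.starProjection_orthogonal_val x
    rw [e]
    exact Submodule.sub_mem _ (Submodule.mem_sup_left hx)
      (Submodule.mem_sup_right (Submodule.starProjection_apply_mem _ x))
  have h := Submodule.finrank_sup_add_finrank_inf_eq W V'
  rw [hinf, finrank_bot, add_zero] at h
  rw [← h]
  exact Submodule.finrank_mono hle

/-- With `W` of dimension `r` frozen, the other `r` Gaussian vectors project to `Wᗮ`, of dimension
`N - r`, with rank at least `min r (N - r)`, and `r + min r (N - r) = min N (2r)`. -/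
theorem ae_le_finrank_sup_grassmannUniform {N r : ℕ} (hr : r ≤ N) :
    ∀ᵐ q ∂((grassmannUniform N r).prod (grassmannUniform N r)),
      min N (2 * r) ≤
        Module.finrank ℝ (q.1 ⊔ q.2 : Submodule ℝ (EuclideanSpace ℝ (Fin N))) := by
  have hms := measurable_span N r
  have hmeas := measurableSet_le_finrank_sup (N := N) (min N (2 * r))
  have hm2 := (hms.prodMap hms) hmeas
  have hker := fun V hV => stdGaussian_submodule_eq_zero (N := N) V hV
  rw [grassmannUniform, Measure.map_prod_map _ _ hms hms]
  refine (ae_map_iff (hms.prodMap hms).aemeasurable hmeas).2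
    ((Measure.ae_prod_iff_ae_ae hm2).2 ((Measure.ae_ae_comm (p := fun v w =>
      min N (2 * r) ≤ Module.finrank ℝ (Submodule.span ℝ (Set.range v) ⊔
        Submodule.span ℝ (Set.range w) : Submodule ℝ (EuclideanSpace ℝ (Fin N)))) hm2).2 ?_))
  filter_upwards [ae_min_le_finrank_span _ hker LinearMap.id r] with w hw
  set W := Submodule.span ℝ (Set.range w) with hW
  have hWr : Module.finrank ℝ W = r := by
    apply le_antisymm
    · exact (finrank_range_le_card w).trans (by simp)
    · rw [LinearMap.range_id, finrank_top, finrank_euclideanSpace_fin, min_eq_left hr] at hw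
      exact hw
  have hrange : Module.finrank ℝ (LinearMap.range (Wᗮ.starProjection :
      EuclideanSpace ℝ (Fin N) →ₗ[ℝ] EuclideanSpace ℝ (Fin N))) = N - r := by
    have h1 := Submodule.finrank_add_finrank_orthogonal W
    rw [hWr, finrank_euclideanSpace_fin] at h1
    have h2 : LinearMap.range (Wᗮ.starProjection :
      EuclideanSpace ℝ (Fin N) →ₗ[ℝ] EuclideanSpace ℝ (Fin N)) = Wᗮ :=
      Submodule.range_starProjection Wᗮ
    rw [h2]
    omega
  filter_upwards [ae_min_le_finrank_span _ hker (Wᗮ.starProjection :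
      EuclideanSpace ℝ (Fin N) →ₗ[ℝ] EuclideanSpace ℝ (Fin N)) r] with v hv
  have h := add_finrank_map_starProjection_le (Submodule.span ℝ (Set.range v)) W
  rw [Submodule.map_span, ← Set.range_comp] at h
  rw [hrange] at hv
  refine le_trans ?_ h
  rw [hWr]
  refine le_trans ?_ (Nat.add_le_add_left hv r)
  omega

/-- By independence the joint law of two images is a product, hence absolutely continuous with
respect to the product of uniform laws, and null sets transfer. The bound on the sum is kept because
the full rank of `Φ (Σᵢ + Σⱼ) Φᵀ` needs it. -/
theorem ae_dimGap_eq {L N r : ℕ} (hrN : r ≤ N) {Ω : Type*} [MeasurableSpace Ω] (P : Measure Ω)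
    [IsProbabilityMeasure P] (V : Fin L → Ω → Submodule ℝ (EuclideanSpace ℝ (Fin N)))
    (hdim : ∀ i ω, Module.finrank ℝ (V i ω) = r)
    (hpdf : ∀ i, HasPDF (V i) P (grassmannUniform N r)) (hindep : iIndepFun V P) :
    ∀ᵐ ω ∂P, ∀ i j, i ≠ j →
      min N (2 * r) ≤ Module.finrank ℝ (V i ω ⊔ V j ω : Submodule ℝ (EuclideanSpace ℝ (Fin N))) ∧
      dimGap (V i ω) (V j ω) = ((2 * min (N - r) r : ℕ) : ℤ) := by
  rw [ae_all_iff]; intro i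
  rw [ae_all_iff]; intro j
  by_cases hij : i = j
  · simp [hij]
  have hi := HasPDF.aemeasurable (V i) P (grassmannUniform N r)
  have hj := HasPDF.aemeasurable (V j) P (grassmannUniform N r)
  have hmap := (indepFun_iff_map_prod_eq_prod_map_map hi hj).1 (hindep.indepFun hij)
  have hac : P.map (fun ω => (V i ω, V j ω)) ≪
      (grassmannUniform N r).prod (grassmannUniform N r) := by
    rw [hmap]
    exact (HasPDF.absolutelyContinuous (X := V i)).prod (HasPDF.absolutelyContinuous (X := V j))
  filter_upwards [ae_of_ae_map (hi.prodMk hj)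
    (hac.ae_le (ae_le_finrank_sup_grassmannUniform hrN))] with ω hω _
  refine ⟨hω, ?_⟩
  have h1 := Submodule.finrank_sup_add_finrank_inf_eq (V i ω) (V j ω)
  have h2 : Module.finrank ℝ (V i ω ⊔ V j ω : Submodule ℝ (EuclideanSpace ℝ (Fin N))) ≤ N :=
    (Submodule.finrank_le _).trans (by simp)
  change min N (2 * r) ≤
    Module.finrank ℝ (V i ω ⊔ V j ω : Submodule ℝ (EuclideanSpace ℝ (Fin N))) at hω
  rw [dimGap, hdim, hdim]
  rw [hdim, hdim] at h1
  omega

/-! ### Generic measurements -/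

theorem finrank_im {N : ℕ} (S : Matrix (Fin N) (Fin N) ℝ) :
    Module.finrank ℝ (im S) = S.rank := by
  rw [im, Matrix.toEuclideanLin_eq_toLin_orthonormal, ← Matrix.rank_eq_finrank_range_toLin]

open scoped MatrixOrder in
-- With `R = √T`, the compressed matrix is `(φ R)(φ R)ᵀ`, so its rank is that of `φ R`, whose rows
-- are the images under `R` of the rows of `φ`.
theorem ae_rank_compress {N : ℕ} (M : ℕ) {T : Matrix (Fin N) (Fin N) ℝ} (hT : T.PosSemidef) :
    ∀ᵐ φ ∂(matrixVolume M N), (φ * T * φ.transpose).rank = min M T.rank := by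
  set R := CFC.sqrt T with hR
  have hRR : R * R = T := CFC.sqrt_mul_sqrt_self T hT.nonneg
  have hRt : R.transpose = R := by
    have := (CFC.sqrt_nonneg T).isSelfAdjoint
    rw [← Matrix.conjTranspose_eq_transpose_of_trivial]
    exact this
  have hrank : R.rank = T.rank := by rw [← hRR]; nth_rw 3 [← hRt]; rw [Matrix.rank_self_mul_transpose]
  have hgen := ae_min_le_finrank_span (volume : Measure (Fin N → ℝ))
    (fun V hV => Measure.addHaar_submodule _ V hV) R.mulVecLin M
  change ∀ᵐ φ : Matrix (Fin M) (Fin N) ℝ ∂(Measure.pi fun _ : Fin M => (volume : Measure (Fin N → ℝ))), _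
  filter_upwards [hgen] with φ hφ
  have h1 : (φ * T * φ.transpose).rank = (φ * R).rank := by
    rw [← Matrix.rank_self_mul_transpose (φ * R), Matrix.transpose_mul, hRt, ← hRR]
    simp only [Matrix.mul_assoc]
  have h2 : (φ * R).rank = Module.finrank ℝ
      (Submodule.span ℝ (Set.range fun i => R.mulVecLin (φ i))) := by
    have hrow : (φ * R).row = fun i => R.mulVecLin (φ i) := by
      funext i
      rw [Matrix.mulVecLin_apply]
      nth_rw 2 [← hRt]
      rw [Matrix.mulVec_transpose]
      exact Matrix.mul_apply_eq_vecMul _ _ _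
    rw [Matrix.rank_eq_finrank_span_row, hrow]
  rw [h1]
  refine le_antisymm (le_min ?_ ?_) ?_
  · exact (Matrix.rank_le_height _)
  · rw [← hrank]; exact Matrix.rank_mul_le_right _ _
  · rw [h2, ← hrank]
    exact hφ

/-- If `(A + B) x = 0`, the nonnegative numbers `xᵀ A x` and `xᵀ B x` sum to zero, so `A x = 0`.
Orthogonal complements turn this inclusion of kernels into one of images. -/
theorem finrank_im_sup_le_rank_add {N : ℕ} {S T : Matrix (Fin N) (Fin N) ℝ} (hS : S.PosSemidef)
    (hT : T.PosSemidef) :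
    Module.finrank ℝ (im S ⊔ im T : Submodule ℝ (EuclideanSpace ℝ (Fin N))) ≤ (S + T).rank := by
  have key : ∀ A B : Matrix (Fin N) (Fin N) ℝ, A.PosSemidef → B.PosSemidef → im A ≤ im (A + B) := by
    intro A B hA hB
    have hAs := Matrix.isSymmetric_toEuclideanLin_iff.2 hA.isHermitian
    have hABs := Matrix.isSymmetric_toEuclideanLin_iff.2 (hA.add hB).isHermitian
    rw [← Submodule.orthogonal_le_orthogonal_iff, im, im, hAs.orthogonal_range,
      hABs.orthogonal_range]
    intro x hx
    rw [LinearMap.mem_ker] at hx ⊢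
    have hx' : (A + B).mulVec x.ofLp = 0 := congrArg WithLp.ofLp hx
    have h0 : x.ofLp ⬝ᵥ A.mulVec x.ofLp + x.ofLp ⬝ᵥ B.mulVec x.ofLp = 0 := by
      rw [← dotProduct_add, ← Matrix.add_mulVec, hx', dotProduct_zero]
    have hA0 := hA.dotProduct_mulVec_nonneg x.ofLp
    have hB0 := hB.dotProduct_mulVec_nonneg x.ofLp
    simp only [star_trivial] at hA0 hB0
    have : A.mulVec x.ofLp = 0 := (hA.dotProduct_mulVec_zero_iff x.ofLp).1 (by
      simp only [star_trivial]; linarith)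
    exact congrArg (WithLp.toLp 2) this
  rw [← finrank_im]
  refine Submodule.finrank_mono (sup_le (key S T hS hT) ?_)
  rw [add_comm]
  exact key T S hT hS

/-! ### Small-noise asymptotics of determinants -/

theorem det_add_smul_one_eq_prod {M : ℕ} {A : Matrix (Fin M) (Fin M) ℝ} (hA : A.IsHermitian)
    (s : ℝ) :
    (A + s • (1 : Matrix (Fin M) (Fin M) ℝ)).det = ∏ k, (hA.eigenvalues k + s) := by
  have h1 : A.charpoly.eval (-s) = (-1) ^ M * (A + s • (1 : Matrix (Fin M) (Fin M) ℝ)).det := by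
    rw [Matrix.eval_charpoly]
    have : Matrix.scalar (Fin M) (-s) - A = -(A + s • (1 : Matrix (Fin M) (Fin M) ℝ)) := by
      rw [Matrix.scalar_apply, ← Matrix.smul_one_eq_diagonal, neg_smul]
      abel
    rw [this, Matrix.det_neg, Fintype.card_fin]
  have h2 : A.charpoly.eval (-s) = (-1) ^ M * ∏ k, (hA.eigenvalues k + s) := by
    rw [hA.charpoly_eq, Polynomial.eval_prod]
    have : ∀ k, Polynomial.eval (-s) (Polynomial.X - Polynomial.C ((hA.eigenvalues k : ℝ) : ℝ)) =
        -(hA.eigenvalues k + s) := fun k => by simp; ring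
    simp only [RCLike.ofReal_real_eq_id, id] at this ⊢
    simp_rw [this]
    rw [Finset.prod_neg, Finset.card_univ, Fintype.card_fin]
  have h3 : ((-1 : ℝ)) ^ M ≠ 0 := by positivity
  exact mul_left_cancel₀ h3 (h1.symm.trans h2)

theorem exists_det_add_smul_one_bounds {M e : ℕ} {A : Matrix (Fin M) (Fin M) ℝ}
    (hA : A.PosSemidef) (he : A.rank + e = M) :
    ∃ c C : ℝ, 0 < c ∧ 0 < C ∧ ∀ s : ℝ, 0 < s → s < 1 →
      c * s ^ e ≤ (A + s • (1 : Matrix (Fin M) (Fin M) ℝ)).det ∧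
      (A + s • (1 : Matrix (Fin M) (Fin M) ℝ)).det ≤ C * s ^ e := by
  classical
  set l := hA.isHermitian.eigenvalues with hl
  have hl0 : ∀ k, 0 ≤ l k := hA.eigenvalues_nonneg
  have hpos : ∀ k, l k ≠ 0 → 0 < l k := fun k h => lt_of_le_of_ne (hl0 k) h.symm
  have hcard : ∀ s : ℝ, ∏ k, (if l k = 0 then s else 1) = s ^ e := by
    intro s
    rw [Finset.prod_ite, Finset.prod_const, Finset.prod_const_one, mul_one]
    congr 1
    have h1 := hA.isHermitian.rank_eq_card_non_zero_eigs
    rw [Fintype.card_subtype] at h1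
    have h2 := Finset.card_filter_add_card_filter_not (s := (Finset.univ : Finset (Fin M)))
      (fun k => l k = 0)
    rw [Finset.card_univ, Fintype.card_fin] at h2
    have h3 : A.rank = (Finset.univ.filter fun k => ¬ l k = 0).card := h1
    omega
  -- Each of the `e` zero eigenvalues contributes a factor `s`; a nonzero eigenvalue `l` contributes
  -- `l + s`, which lies between `l` and `l + 1`.
  refine ⟨∏ k, (if l k = 0 then 1 else l k), ∏ k, (if l k = 0 then 1 else l k + 1), ?_, ?_, ?_⟩
  · refine Finset.prod_pos fun k _ => ?_
    split_ifs with h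
    · exact one_pos
    · exact hpos k h
  · refine Finset.prod_pos fun k _ => ?_
    split_ifs with h
    · exact one_pos
    · linarith [hpos k h]
  · intro s hs0 hs1
    rw [det_add_smul_one_eq_prod hA.isHermitian, ← hcard, ← Finset.prod_mul_distrib,
      ← Finset.prod_mul_distrib]
    constructor
    · refine Finset.prod_le_prod (fun k _ => ?_) fun k _ => ?_
      · have := hl0 k
        split_ifs <;> positivity
      · change _ ≤ l k + s
        split_ifs with h
        · simp [h]
        · linarith
    · refine Finset.prod_le_prod (fun k _ => ?_) fun k _ => ?_
      · have := hl0 k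
        change 0 ≤ l k + s
        positivity
      · change l k + s ≤ _
        split_ifs with h
        · simp [h]
        · linarith

/-! ### Overlap integrals of Gaussian densities -/

theorem det_inv_add_inv {M : ℕ} {K₁ K₂ : Matrix (Fin M) (Fin M) ℝ} (h₁ : K₁.PosDef)
    (h₂ : K₂.PosDef) : (K₁⁻¹ + K₂⁻¹).det = (K₁ + K₂).det / (K₁.det * K₂.det) := by
  have u₁ : IsUnit K₁.det := isUnit_iff_ne_zero.2 h₁.det_pos.ne'
  have u₂ : IsUnit K₂.det := isUnit_iff_ne_zero.2 h₂.det_pos.ne'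
  have : K₁⁻¹ + K₂⁻¹ = K₁⁻¹ * (K₁ + K₂) * K₂⁻¹ := by
    rw [Matrix.mul_add, Matrix.nonsing_inv_mul _ u₁, Matrix.add_mul, Matrix.one_mul,
      Matrix.mul_assoc, Matrix.mul_nonsing_inv _ u₂, Matrix.mul_one, add_comm]
  rw [this, Matrix.det_mul, Matrix.det_mul, Matrix.det_nonsing_inv, Matrix.det_nonsing_inv,
    Ring.inverse_eq_inv']
  have := h₁.det_pos.ne'
  have := h₂.det_pos.ne'
  field_simp

/-- The geometric mean of two centred Gaussian densities is an unnormalized Gaussian whose precision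
matrix is the average of the two. -/
theorem lintegral_sqrt_mul_gaussianDensity {M : ℕ} {K₁ K₂ : Matrix (Fin M) (Fin M) ℝ}
    (h₁ : K₁.PosDef) (h₂ : K₂.PosDef) :
    ∫⁻ y, ENNReal.ofReal (Real.sqrt (gaussianDensity K₁ y * gaussianDensity K₂ y)) =
      ENNReal.ofReal (Real.sqrt
        (2 ^ M * Real.sqrt (K₁.det * K₂.det) / (K₁ + K₂).det)) := by
  set Q : Matrix (Fin M) (Fin M) ℝ := (1 / 2 : ℝ) • (K₁⁻¹ + K₂⁻¹) with hQdef
  have hQ : Q.PosDef := (h₁.inv.add h₂.inv).smul (by norm_num)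
  have d₁ := h₁.det_pos
  have d₂ := h₂.det_pos
  have dD := (h₁.add h₂).det_pos
  have hpi : (0 : ℝ) < (2 * Real.pi) ^ M := by positivity
  have hQdet : Q.det = (1 / 2) ^ M * ((K₁ + K₂).det / (K₁.det * K₂.det)) := by
    rw [hQdef, Matrix.det_smul, det_inv_add_inv h₁ h₂, Fintype.card_fin]
  set a : ℝ := ((2 * Real.pi) ^ M * Real.sqrt (K₁.det * K₂.det))⁻¹ with ha
  have e : ∀ y, Real.sqrt (gaussianDensity K₁ y * gaussianDensity K₂ y) =
      Real.sqrt a * Real.exp (-(y.ofLp ⬝ᵥ Q.mulVec y.ofLp) / 2) := by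
    intro y
    have h : gaussianDensity K₁ y * gaussianDensity K₂ y =
        a * Real.exp (-(y.ofLp ⬝ᵥ Q.mulVec y.ofLp) / 2) ^ 2 := by
      rw [gaussianDensity, gaussianDensity, mul_mul_mul_comm, ← Real.exp_add, ← mul_inv,
        ← Real.sqrt_mul (by positivity),
        show (2 * Real.pi) ^ M * K₁.det * ((2 * Real.pi) ^ M * K₂.det) =
          ((2 * Real.pi) ^ M) ^ 2 * (K₁.det * K₂.det) by ring,
        Real.sqrt_mul (by positivity), Real.sqrt_sq hpi.le, ← Real.exp_nat_mul]
      congr 2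
      rw [hQdef, Matrix.smul_mulVec, Matrix.add_mulVec, dotProduct_smul, dotProduct_add]
      simp only [smul_eq_mul]
      push_cast
      ring
    rw [h, Real.sqrt_mul (by positivity), Real.sqrt_sq (Real.exp_pos _).le]
  simp_rw [e, ENNReal.ofReal_mul (Real.sqrt_nonneg a)]
  rw [lintegral_const_mul' _ _ ENNReal.ofReal_ne_top, lintegral_exp_neg_quadratic hQ,
    ← ENNReal.ofReal_mul (Real.sqrt_nonneg a), ← Real.sqrt_mul (by positivity), hQdet]
  congr 2
  have hs : 0 < Real.sqrt (K₁.det * K₂.det) := by positivity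
  have hss : K₁.det * K₂.det = Real.sqrt (K₁.det * K₂.det) ^ 2 :=
    (Real.sq_sqrt (by positivity)).symm
  rw [ha]
  set t := Real.sqrt (K₁.det * K₂.det)
  rw [hss, one_div, inv_pow]
  field_simp

/-- Both densities dominate one Gaussian function: the form `K₁⁻¹ + K₂⁻¹` exceeds each of its
summands, and the larger determinant gives the smaller prefactor. -/
theorem le_lintegral_min_gaussianDensity {M : ℕ} {K₁ K₂ : Matrix (Fin M) (Fin M) ℝ}
    (h₁ : K₁.PosDef) (h₂ : K₂.PosDef) :
    ENNReal.ofReal (Real.sqrt (min K₁.det K₂.det / (K₁ + K₂).det)) ≤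
      ∫⁻ y, ENNReal.ofReal (min (gaussianDensity K₁ y) (gaussianDensity K₂ y)) := by
  have hQ : (K₁⁻¹ + K₂⁻¹).PosDef := h₁.inv.add h₂.inv
  have d₁ := h₁.det_pos
  have d₂ := h₂.det_pos
  have dD := (h₁.add h₂).det_pos
  have hpi : (0 : ℝ) < (2 * Real.pi) ^ M := by positivity
  set m := max K₁.det K₂.det with hm
  have hmpos : 0 < m := lt_max_of_lt_left d₁
  have hle : ∀ K : Matrix (Fin M) (Fin M) ℝ, 0 < K.det → K.det ≤ m →
      ∀ y : EuclideanSpace ℝ (Fin M),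
      y.ofLp ⬝ᵥ K⁻¹.mulVec y.ofLp ≤ y.ofLp ⬝ᵥ (K₁⁻¹ + K₂⁻¹).mulVec y.ofLp →
      (Real.sqrt ((2 * Real.pi) ^ M * m))⁻¹ *
        Real.exp (-(y.ofLp ⬝ᵥ (K₁⁻¹ + K₂⁻¹).mulVec y.ofLp) / 2) ≤ gaussianDensity K y := by
    intro K hK hKm y hy
    rw [gaussianDensity]
    gcongr
  have hq : ∀ K : Matrix (Fin M) (Fin M) ℝ, K.PosDef → ∀ y : EuclideanSpace ℝ (Fin M),
      0 ≤ y.ofLp ⬝ᵥ K⁻¹.mulVec y.ofLp := by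
    intro K hK y
    simpa using hK.inv.posSemidef.dotProduct_mulVec_nonneg y.ofLp
  have hdet : m * min K₁.det K₂.det = K₁.det * K₂.det := max_mul_min _ _
  have hconst : Real.sqrt (min K₁.det K₂.det / (K₁ + K₂).det) =
      (Real.sqrt ((2 * Real.pi) ^ M * m))⁻¹ *
        Real.sqrt ((2 * Real.pi) ^ M / (K₁⁻¹ + K₂⁻¹).det) := by
    rw [← Real.sqrt_inv, ← Real.sqrt_mul (by positivity), det_inv_add_inv h₁ h₂, ← hdet]
    congr 1
    field_simp
  rw [hconst, ENNReal.ofReal_mul (by positivity), ← lintegral_exp_neg_quadratic hQ,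
    ← lintegral_const_mul' _ _ ENNReal.ofReal_ne_top]
  refine lintegral_mono fun y => ?_
  rw [← ENNReal.ofReal_mul (by positivity)]
  refine ENNReal.ofReal_le_ofReal (le_min (hle K₁ d₁ (le_max_left _ _) y ?_)
    (hle K₂ d₂ (le_max_right _ _) y ?_))
  · rw [Matrix.add_mulVec, dotProduct_add]
    linarith [hq K₂ h₂ y]
  · rw [Matrix.add_mulVec, dotProduct_add]
    linarith [hq K₁ h₁ y]

/-! ### Bounds on the misclassification probability -/

section Error

variable {L M N : ℕ} {p : PMF (Fin L)} {S : Fin L → Matrix (Fin N) (Fin N) ℝ}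
  {φ : Matrix (Fin M) (Fin N) ℝ} {s : ℝ} {c : EuclideanSpace ℝ (Fin M) → Fin L}

theorem measurable_condDensity (φ : Matrix (Fin M) (Fin N) ℝ) (S : Matrix (Fin N) (Fin N) ℝ)
    (s : ℝ) : Measurable (condDensity φ S s) :=
  measurable_gaussianDensity _

theorem condDensity_nonneg (φ : Matrix (Fin M) (Fin N) ℝ) (S : Matrix (Fin N) (Fin N) ℝ)
    (s : ℝ) (y : EuclideanSpace ℝ (Fin M)) : 0 ≤ condDensity φ S s y :=
  gaussianDensity_nonneg _ _

theorem errorProb_eq_sum_lintegral (hS : ∀ i, (S i).PosSemidef) (hs : 0 < s) (hc : Measurable c) :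
    errorProb p S φ s c = ∑ i, ∫⁻ y, {y | c y ≠ i}.indicator
      (fun y => ENNReal.ofReal ((p i).toReal * condDensity φ (S i) s y)) y := by
  refine Finset.sum_congr rfl fun i _ => ?_
  have hA : MeasurableSet {y | c y ≠ i} := (hc (measurableSet_singleton i)).compl
  rw [measurementLaw_apply φ (hS i) hs hA, lintegral_indicator hA,
    ← lintegral_const_mul' _ _ (p.apply_ne_top i)]
  refine lintegral_congr fun y => ?_
  rw [ENNReal.ofReal_mul ENNReal.toReal_nonneg, ENNReal.ofReal_toReal (p.apply_ne_top i)]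

/-- Where the classifier answers `j ≠ i`, the MAP rule gives `pᵢ fᵢ ≤ pⱼ fⱼ`; multiplying by `pᵢ fᵢ`
and using that priors are at most `1` yields `pᵢ fᵢ ≤ √(fᵢ fⱼ)`. -/
theorem errorProb_le_sum_lintegral_sqrt (hS : ∀ i, (S i).PosSemidef) (hs : 0 < s)
    (hc : IsMAP p S φ s c) :
    errorProb p S φ s c ≤ ∑ i, ∑ j ∈ Finset.univ.erase i,
      ∫⁻ y, ENNReal.ofReal (Real.sqrt (condDensity φ (S i) s y * condDensity φ (S j) s y)) := by
  rw [errorProb_eq_sum_lintegral hS hs hc.measurable]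
  refine Finset.sum_le_sum fun i _ => ?_
  have hmeas : ∀ j, Measurable fun y =>
      ENNReal.ofReal (Real.sqrt (condDensity φ (S i) s y * condDensity φ (S j) s y)) := fun j =>
    ((measurable_condDensity φ (S i) s).mul (measurable_condDensity φ (S j) s)).sqrt.ennreal_ofReal
  rw [← lintegral_finsetSum _ fun j _ => hmeas j]
  refine lintegral_mono fun y => ?_
  refine Set.indicator_apply_le' (fun hy => ?_) fun _ => zero_le
  refine le_trans ?_ (Finset.single_le_sum (f := fun j => ENNReal.ofReal
    (Real.sqrt (condDensity φ (S i) s y * condDensity φ (S j) s y))) (fun _ _ => zero_le)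
    (Finset.mem_erase.2 ⟨hy, Finset.mem_univ (c y)⟩))
  refine ENNReal.ofReal_le_ofReal (Real.le_sqrt_of_sq_le ?_)
  have hle := hc.le y i
  have hp : ∀ k, (p k).toReal ≤ 1 := fun k =>
    ENNReal.toReal_le_of_le_ofReal zero_le_one (by simpa using p.coe_le_one k)
  have h0 : ∀ k, 0 ≤ (p k).toReal := fun k => ENNReal.toReal_nonneg
  have f0 : ∀ k, 0 ≤ condDensity φ (S k) s y := fun k => condDensity_nonneg _ _ _ _
  calc ((p i).toReal * condDensity φ (S i) s y) ^ 2
      = ((p i).toReal * condDensity φ (S i) s y) * (condDensity φ (S i) s y * (p i).toReal) := by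
        ring
    _ ≤ (1 * condDensity φ (S i) s y) * (condDensity φ (S (c y)) s y * 1) := by
        have h1 : condDensity φ (S (c y)) s y * (p (c y)).toReal ≤
            condDensity φ (S (c y)) s y * 1 := mul_le_mul_of_nonneg_left (hp _) (f0 _)
        exact mul_le_mul (mul_le_mul_of_nonneg_right (hp i) (f0 i)) (hle.trans h1)
          (mul_nonneg (f0 i) (h0 i)) (by simpa using f0 i)
    _ = _ := by ring

/-- At every `y` any decision is wrong for at least one of `i` and `j`, and that class alone
contributes at least the minimum. -/
theorem lintegral_min_le_errorProb (hS : ∀ i, (S i).PosSemidef) (hs : 0 < s) (hc : Measurable c)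
    {i j : Fin L} (hij : i ≠ j) :
    ENNReal.ofReal (min (p i).toReal (p j).toReal) *
        ∫⁻ y, ENNReal.ofReal (min (condDensity φ (S i) s y) (condDensity φ (S j) s y)) ≤
      errorProb p S φ s c := by
  have hmeas : ∀ k, Measurable fun y => {y | c y ≠ k}.indicator
      (fun y => ENNReal.ofReal ((p k).toReal * condDensity φ (S k) s y)) y := fun k =>
    (((measurable_condDensity φ (S k) s).const_mul _).ennreal_ofReal).indicator
      (hc (measurableSet_singleton k)).compl
  rw [errorProb_eq_sum_lintegral hS hs hc, ← lintegral_finsetSum _ fun k _ => hmeas k,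
    ← lintegral_const_mul' _ _ ENNReal.ofReal_ne_top]
  refine lintegral_mono fun y => ?_
  have f0 : ∀ k, 0 ≤ condDensity φ (S k) s y := fun k => condDensity_nonneg _ _ _ _
  have key : ∀ k, c y ≠ k → min (p i).toReal (p j).toReal ≤ (p k).toReal →
      min (condDensity φ (S i) s y) (condDensity φ (S j) s y) ≤ condDensity φ (S k) s y →
      ENNReal.ofReal (min (p i).toReal (p j).toReal) *
        ENNReal.ofReal (min (condDensity φ (S i) s y) (condDensity φ (S j) s y)) ≤
      ∑ k, {y | c y ≠ k}.indicator
        (fun y => ENNReal.ofReal ((p k).toReal * condDensity φ (S k) s y)) y := by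
    intro k hk hp hf
    refine le_trans ?_ (Finset.single_le_sum (f := fun k => {y | c y ≠ k}.indicator
      (fun y => ENNReal.ofReal ((p k).toReal * condDensity φ (S k) s y)) y)
      (fun _ _ => zero_le) (Finset.mem_univ k))
    rw [← ENNReal.ofReal_mul (le_min ENNReal.toReal_nonneg ENNReal.toReal_nonneg)]
    rw [Set.indicator_of_mem (show y ∈ {y | c y ≠ k} from hk)]
    exact ENNReal.ofReal_le_ofReal (mul_le_mul hp hf (le_min (f0 i) (f0 j)) ENNReal.toReal_nonneg)
  by_cases h : c y = i
  · exact key j (h ▸ hij) (min_le_right _ _) (min_le_right _ _)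
  · exact key i h (min_le_left _ _) (min_le_left _ _)

/-- The Gaussian densities are strictly positive, so the MAP rule never selects a class of prior
zero when another has positive prior. -/
theorem errorProb_eq_zero (hS : ∀ i, (S i).PosSemidef) (hs : 0 < s) (hc : IsMAP p S φ s c)
    (hp : ∀ i j, i ≠ j → p i = 0 ∨ p j = 0) : errorProb p S φ s c = 0 := by
  refine Finset.sum_eq_zero fun i _ => ?_
  by_cases hi : p i = 0
  · rw [hi, zero_mul]
  have : {y | c y ≠ i} = ∅ := by
    refine Set.eq_empty_of_forall_notMem fun y hy => ?_
    have hcy := (hp (c y) i hy).resolve_right hi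
    have hle := hc.le y i
    rw [hcy, ENNReal.toReal_zero, mul_zero] at hle
    have hdet := (posDef_add_smul_one (posSemidef_compress φ (hS i)) hs).det_pos
    have hf : 0 < condDensity φ (S i) s y := by
      unfold condDensity gaussianDensity
      positivity
    exact absurd hle (not_le.2 (mul_pos hf (ENNReal.toReal_pos hi (p.apply_ne_top i))))
  rw [this, measure_empty, mul_zero]

end Error

section Decay

variable {L M N e : ℕ} {p : PMF (Fin L)} {S : Fin L → Matrix (Fin N) (Fin N) ℝ}
  {φ : Matrix (Fin M) (Fin N) ℝ}

theorem compress_add_eq (φ : Matrix (Fin M) (Fin N) ℝ) (A B : Matrix (Fin N) (Fin N) ℝ) (s : ℝ) :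
    (φ * A * φ.transpose + s • (1 : Matrix (Fin M) (Fin M) ℝ)) +
      (φ * B * φ.transpose + s • (1 : Matrix (Fin M) (Fin M) ℝ)) =
      φ * (A + B) * φ.transpose + (2 * s) • (1 : Matrix (Fin M) (Fin M) ℝ) := by
  rw [Matrix.mul_add, Matrix.add_mul, two_mul, add_smul]
  abel

theorem exists_lintegral_sqrt_condDensity_le {A B : Matrix (Fin N) (Fin N) ℝ}
    (hA : A.PosSemidef) (hB : B.PosSemidef) (hrA : (φ * A * φ.transpose).rank + e = M)
    (hrB : (φ * B * φ.transpose).rank + e = M) (hr : (φ * (A + B) * φ.transpose).rank = M) :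
    ∃ C : ℝ, 0 < C ∧ ∀ s : ℝ, 0 < s → s < 1 / 2 →
      ∫⁻ y, ENNReal.ofReal (Real.sqrt (condDensity φ A s y * condDensity φ B s y)) ≤
        ENNReal.ofReal (C * Real.sqrt (s ^ e)) := by
  obtain ⟨_, CA, _, hCA, bA⟩ := exists_det_add_smul_one_bounds (posSemidef_compress φ hA) hrA
  obtain ⟨_, CB, _, hCB, bB⟩ := exists_det_add_smul_one_bounds (posSemidef_compress φ hB) hrB
  -- The sum of the two covariances carries noise `2 s`; full rank means exponent `0`, and `s < 1 /
  -- 2` keeps `2 s` in the range of the bounds.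
  obtain ⟨c, _, hc, _, b⟩ := exists_det_add_smul_one_bounds (e := 0)
    (posSemidef_compress φ (hA.add hB)) hr
  refine ⟨Real.sqrt (2 ^ M * Real.sqrt (CA * CB) / c), by positivity, fun s hs hs2 => ?_⟩
  have hKA := posDef_add_smul_one (posSemidef_compress φ hA) hs
  have hKB := posDef_add_smul_one (posSemidef_compress φ hB) hs
  have h := lintegral_sqrt_mul_gaussianDensity hKA hKB
  refine h.trans_le (ENNReal.ofReal_le_ofReal ?_)
  rw [compress_add_eq, ← Real.sqrt_mul (by positivity)]
  have h1 := (bA s hs (by linarith)).2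
  have h2 := (bB s hs (by linarith)).2
  have h3 := (b (2 * s) (by linarith) (by linarith)).1
  rw [pow_zero, mul_one] at h3
  refine Real.sqrt_le_sqrt ?_
  have h4 : Real.sqrt ((φ * A * φ.transpose + s • (1 : Matrix (Fin M) (Fin M) ℝ)).det *
      (φ * B * φ.transpose + s • (1 : Matrix (Fin M) (Fin M) ℝ)).det) ≤
      Real.sqrt (CA * CB) * s ^ e := by
    rw [← Real.sqrt_sq (show 0 ≤ s ^ e by positivity), ← Real.sqrt_mul (by positivity)]
    refine Real.sqrt_le_sqrt ((mul_le_mul h1 h2 hKB.det_pos.le (by positivity)).trans_eq ?_)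
    ring
  calc _ ≤ 2 ^ M * (Real.sqrt (CA * CB) * s ^ e) / c := by gcongr
    _ = _ := by ring

theorem exists_le_lintegral_min_condDensity {A B : Matrix (Fin N) (Fin N) ℝ}
    (hA : A.PosSemidef) (hB : B.PosSemidef) (hrA : (φ * A * φ.transpose).rank + e = M)
    (hrB : (φ * B * φ.transpose).rank + e = M) (hr : (φ * (A + B) * φ.transpose).rank = M) :
    ∃ c : ℝ, 0 < c ∧ ∀ s : ℝ, 0 < s → s < 1 / 2 →
      ENNReal.ofReal (c * Real.sqrt (s ^ e)) ≤
        ∫⁻ y, ENNReal.ofReal (min (condDensity φ A s y) (condDensity φ B s y)) := by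
  obtain ⟨cA, _, hcA, _, bA⟩ := exists_det_add_smul_one_bounds (posSemidef_compress φ hA) hrA
  obtain ⟨cB, _, hcB, _, bB⟩ := exists_det_add_smul_one_bounds (posSemidef_compress φ hB) hrB
  obtain ⟨_, C, _, hC, b⟩ := exists_det_add_smul_one_bounds (e := 0)
    (posSemidef_compress φ (hA.add hB)) hr
  have hmin : 0 < min cA cB := lt_min hcA hcB
  refine ⟨Real.sqrt (min cA cB / C), by positivity, fun s hs hs2 => ?_⟩
  have hKA := posDef_add_smul_one (posSemidef_compress φ hA) hs
  have hKB := posDef_add_smul_one (posSemidef_compress φ hB) hs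
  refine le_trans (ENNReal.ofReal_le_ofReal ?_) (le_lintegral_min_gaussianDensity hKA hKB)
  have hpos := (hKA.add hKB).det_pos
  rw [compress_add_eq] at hpos ⊢
  rw [← Real.sqrt_mul (by positivity)]
  have h1 := (bA s hs (by linarith)).1
  have h2 := (bB s hs (by linarith)).1
  have h3 := (b (2 * s) (by linarith) (by linarith)).2
  rw [pow_zero, mul_one] at h3
  have hse : 0 < s ^ e := by positivity
  refine Real.sqrt_le_sqrt ?_
  have h4 : min cA cB * s ^ e ≤
      min (φ * A * φ.transpose + s • (1 : Matrix (Fin M) (Fin M) ℝ)).det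
        (φ * B * φ.transpose + s • (1 : Matrix (Fin M) (Fin M) ℝ)).det :=
    le_min ((mul_le_mul_of_nonneg_right (min_le_left _ _) hse.le).trans h1)
      ((mul_le_mul_of_nonneg_right (min_le_right _ _) hse.le).trans h2)
  calc _ = min cA cB * s ^ e / C := by ring
    _ ≤ min (φ * A * φ.transpose + s • (1 : Matrix (Fin M) (Fin M) ℝ)).det
        (φ * B * φ.transpose + s • (1 : Matrix (Fin M) (Fin M) ℝ)).det / C := by gcongr
    _ ≤ _ := by
        have := lt_min hKA.det_pos hKB.det_pos
        gcongr

theorem exists_errorProb_le (hS : ∀ i, (S i).PosSemidef)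
    (hr : ∀ i, (φ * S i * φ.transpose).rank + e = M)
    (hr2 : ∀ i j, i ≠ j → (φ * (S i + S j) * φ.transpose).rank = M) :
    ∃ C : ℝ, 0 < C ∧ ∀ s : ℝ, 0 < s → s < 1 / 2 → ∀ c, IsMAP p S φ s c →
      errorProb p S φ s c ≤ ENNReal.ofReal (C * Real.sqrt (s ^ e)) := by
  have h : ∀ i j, ∃ C : ℝ, 0 < C ∧ (i ≠ j → ∀ s : ℝ, 0 < s → s < 1 / 2 →
      ∫⁻ y, ENNReal.ofReal (Real.sqrt (condDensity φ (S i) s y * condDensity φ (S j) s y)) ≤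
        ENNReal.ofReal (C * Real.sqrt (s ^ e))) := by
    intro i j
    by_cases hij : i = j
    · exact ⟨1, one_pos, fun h => absurd hij h⟩
    · obtain ⟨C, hC, b⟩ :=
        exists_lintegral_sqrt_condDensity_le (hS i) (hS j) (hr i) (hr j) (hr2 i j hij)
      exact ⟨C, hC, fun _ => b⟩
  choose C hC b using h
  have h0 : 0 ≤ ∑ i, ∑ j ∈ Finset.univ.erase i, C i j :=
    Finset.sum_nonneg fun i _ => Finset.sum_nonneg fun j _ => (hC i j).le
  -- The added `1` keeps the constant positive when there is only one class and the sum is empty.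
  refine ⟨1 + ∑ i, ∑ j ∈ Finset.univ.erase i, C i j, by linarith, fun s hs hs2 c hc => ?_⟩
  refine (errorProb_le_sum_lintegral_sqrt hS hs hc).trans ?_
  have hq : 0 ≤ Real.sqrt (s ^ e) := Real.sqrt_nonneg _
  calc _ ≤ ∑ i, ∑ j ∈ Finset.univ.erase i, ENNReal.ofReal (C i j * Real.sqrt (s ^ e)) :=
        Finset.sum_le_sum fun i _ => Finset.sum_le_sum fun j hj =>
          b i j (Finset.ne_of_mem_erase hj).symm s hs hs2
    _ = ENNReal.ofReal ((∑ i, ∑ j ∈ Finset.univ.erase i, C i j) * Real.sqrt (s ^ e)) := by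
        rw [Finset.sum_mul, ENNReal.ofReal_sum_of_nonneg fun i _ =>
          mul_nonneg (Finset.sum_nonneg fun j _ => (hC i j).le) hq]
        refine Finset.sum_congr rfl fun i _ => ?_
        rw [Finset.sum_mul, ENNReal.ofReal_sum_of_nonneg fun j _ => mul_nonneg (hC i j).le hq]
    _ ≤ _ := ENNReal.ofReal_le_ofReal (mul_le_mul_of_nonneg_right (by linarith) hq)

theorem exists_le_errorProb (hS : ∀ i, (S i).PosSemidef)
    (hr : ∀ i, (φ * S i * φ.transpose).rank + e = M)
    (hr2 : ∀ i j, i ≠ j → (φ * (S i + S j) * φ.transpose).rank = M)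
    {i j : Fin L} (hij : i ≠ j) (hi : p i ≠ 0) (hj : p j ≠ 0) :
    ∃ b : ℝ, 0 < b ∧ ∀ s : ℝ, 0 < s → s < 1 / 2 → ∀ c, IsMAP p S φ s c →
      ENNReal.ofReal (b * Real.sqrt (s ^ e)) ≤ errorProb p S φ s c := by
  obtain ⟨b, hb, h⟩ :=
    exists_le_lintegral_min_condDensity (hS i) (hS j) (hr i) (hr j) (hr2 i j hij)
  have hp : 0 < min (p i).toReal (p j).toReal :=
    lt_min (ENNReal.toReal_pos hi (p.apply_ne_top i)) (ENNReal.toReal_pos hj (p.apply_ne_top j))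
  refine ⟨min (p i).toReal (p j).toReal * b, by positivity, fun s hs hs2 c hc => ?_⟩
  refine le_trans ?_ (lintegral_min_le_errorProb hS hs hc.measurable hij)
  rw [mul_assoc, ENNReal.ofReal_mul hp.le]
  exact mul_le_mul_right (h s hs hs2) _

end Decay

/-! ### Decay exponents -/

theorem tendsto_neg_log_div_of_bounds {F : ℝ → ℝ≥0∞} {e : ℕ} {b C : ℝ} (hb : 0 < b) (hC : 0 < C)
    (hF : ∀ s : ℝ, 0 < s → s < 1 / 2 → ENNReal.ofReal (b * Real.sqrt (s ^ e)) ≤ F s ∧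
      F s ≤ ENNReal.ofReal (C * Real.sqrt (s ^ e))) :
    Tendsto (fun s : ℝ => -ENNReal.log (F s) / ((Real.log (1 / s) : ℝ) : EReal)) (𝓝[>] 0)
      (𝓝 (((e : ℝ) / 2 : ℝ) : EReal)) := by
  have hsmall : ∀ᶠ s : ℝ in 𝓝[>] 0, 0 < s ∧ s < 1 / 2 :=
    Ioo_mem_nhdsGT (by norm_num : (0 : ℝ) < 1 / 2)
  have hlog : Tendsto (fun s : ℝ => Real.log (1 / s)) (𝓝[>] 0) atTop := by
    simp only [one_div]
    exact Real.tendsto_log_atTop.comp tendsto_inv_nhdsGT_zero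
  have hlim : ∀ a : ℝ, Tendsto (fun s : ℝ => -Real.log a / Real.log (1 / s) + (e : ℝ) / 2)
      (𝓝[>] 0) (𝓝 ((e : ℝ) / 2)) := by
    intro a
    simpa using (hlog.const_div_atTop (-Real.log a)).add_const ((e : ℝ) / 2)
  -- A constant factor only shifts the quotient by `-log a / log (1 / s)`, which tends to zero; an
  -- upper bound on `F` thus bounds the exponent from below and conversely.
  have hexp : ∀ a s : ℝ, 0 < a → 0 < s → s < 1 / 2 →
      -Real.log (a * Real.sqrt (s ^ e)) / Real.log (1 / s) =
        -Real.log a / Real.log (1 / s) + (e : ℝ) / 2 := by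
    intro a s ha hs hs2
    have hl : 0 < Real.log (1 / s) := Real.log_pos (by rw [lt_div_iff₀ hs]; linarith)
    rw [Real.log_mul ha.ne' (by positivity), Real.log_sqrt (by positivity), Real.log_pow]
    have : Real.log s = -Real.log (1 / s) := by rw [one_div, Real.log_inv, neg_neg]
    rw [this]
    field_simp
    ring
  have hreal : Tendsto (fun s : ℝ => -Real.log (F s).toReal / Real.log (1 / s)) (𝓝[>] 0)
      (𝓝 ((e : ℝ) / 2)) := by
    refine tendsto_of_tendsto_of_tendsto_of_le_of_le' (hlim C) (hlim b) ?_ ?_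
    · filter_upwards [hsmall] with s ⟨hs, hs2⟩
      have hl : 0 < Real.log (1 / s) := Real.log_pos (by rw [lt_div_iff₀ hs]; linarith)
      have hq : 0 < Real.sqrt (s ^ e) := by positivity
      obtain ⟨h1, h2⟩ := hF s hs hs2
      have h1' := (ENNReal.ofReal_le_iff_le_toReal (ne_top_of_le_ne_top ENNReal.ofReal_ne_top h2)).1 h1
      have h2' := ENNReal.toReal_le_of_le_ofReal (by positivity) h2
      have h0 : 0 < (F s).toReal := lt_of_lt_of_le (by positivity) h1'
      rw [← hexp C s hC hs hs2]
      have := Real.log_le_log h0 h2'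
      gcongr
    · filter_upwards [hsmall] with s ⟨hs, hs2⟩
      have hl : 0 < Real.log (1 / s) := Real.log_pos (by rw [lt_div_iff₀ hs]; linarith)
      have hq : 0 < Real.sqrt (s ^ e) := by positivity
      obtain ⟨h1, h2⟩ := hF s hs hs2
      have h1' := (ENNReal.ofReal_le_iff_le_toReal (ne_top_of_le_ne_top ENNReal.ofReal_ne_top h2)).1 h1
      rw [← hexp b s hb hs hs2]
      have := Real.log_le_log (by positivity) h1'
      gcongr
  refine ((continuous_coe_real_ereal.tendsto _).comp hreal).congr' ?_
  filter_upwards [hsmall] with s ⟨hs, hs2⟩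
  obtain ⟨h1, h2⟩ := hF s hs hs2
  have htop := ne_top_of_le_ne_top ENNReal.ofReal_ne_top h2
  have hq : 0 < Real.sqrt (s ^ e) := by positivity
  have h0 : F s ≠ 0 := fun h => by
    rw [h, nonpos_iff_eq_zero, ENNReal.ofReal_eq_zero] at h1
    exact absurd h1 (not_le.2 (by positivity))
  rw [ENNReal.log_pos_real h0 htop]
  rw [← EReal.coe_neg, ← EReal.coe_div]
  rfl

theorem exists_tendsto_exponent {L M N e : ℕ} {p : PMF (Fin L)}
    {S : Fin L → Matrix (Fin N) (Fin N) ℝ} {φ : Matrix (Fin M) (Fin N) ℝ}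
    (hS : ∀ i, (S i).PosSemidef) (hr : ∀ i, (φ * S i * φ.transpose).rank + e = M)
    (hr2 : ∀ i j, i ≠ j → (φ * (S i + S j) * φ.transpose).rank = M)
    {c : ℝ → EuclideanSpace ℝ (Fin M) → Fin L} (hc : ∀ s, 0 < s → IsMAP p S φ s (c s)) :
    ∃ ℓ : EReal, (((e : ℝ) / 2 : ℝ) : EReal) ≤ ℓ ∧
      Tendsto (fun s : ℝ => -ENNReal.log (errorProb p S φ s (c s)) /
        ((Real.log (1 / s) : ℝ) : EReal)) (𝓝[>] 0) (𝓝 ℓ) := by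
  by_cases hp : ∀ i j, i ≠ j → p i = 0 ∨ p j = 0
  · refine ⟨⊤, le_top, tendsto_const_nhds.congr' ?_⟩
    filter_upwards [Ioo_mem_nhdsGT (by norm_num : (0 : ℝ) < 1)] with s ⟨hs, hs1⟩
    have hl : 0 < Real.log (1 / s) := Real.log_pos (by rw [lt_div_iff₀ hs]; linarith)
    rw [errorProb_eq_zero hS hs (hc s hs) hp, ENNReal.log_zero, EReal.neg_bot,
      EReal.top_div_of_pos_ne_top (by exact_mod_cast hl) (EReal.coe_ne_top _)]
  · push Not at hp
    obtain ⟨i, j, hij, hi, hj⟩ := hp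
    obtain ⟨C, hC, hle⟩ := exists_errorProb_le (p := p) hS hr hr2
    obtain ⟨b, hb, hge⟩ := exists_le_errorProb hS hr hr2 hij hi hj
    exact ⟨_, le_rfl, tendsto_neg_log_div_of_bounds hb hC fun s hs hs2 =>
      ⟨hge s hs hs2 _ (hc s hs), hle s hs hs2 _ (hc s hs)⟩⟩

end GaussClass

/-! ### The number of measurements and the resulting exponent -/

theorem proposition2 {L N r M : ℕ} (hrN : r < N)
    -- class priors
    (p : PMF (Fin L))
    -- random source covariances of rank `r`, whose images are independent with a density
    {Ω : Type*} [MeasurableSpace Ω] (P : Measure Ω) [IsProbabilityMeasure P]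
    (S : Fin L → Ω → Matrix (Fin N) (Fin N) ℝ)
    (hS : ∀ i ω, (S i ω).PosSemidef)
    (hrank : ∀ i ω, Module.finrank ℝ (GaussClass.im (S i ω)) = r)
    (hpdf : ∀ i, HasPDF (fun ω => GaussClass.im (S i ω)) P (GaussClass.grassmannUniform N r))
    (hindep : iIndepFun (fun i ω => GaussClass.im (S i ω)) P)
    -- random left rotation-invariant measurement matrix
    {Ω' : Type*} [MeasurableSpace Ω'] (Q : Measure Ω') [IsProbabilityMeasure Q]
    (Φ : Ω' → Matrix (Fin M) (Fin N) ℝ)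
    (hΦ : GaussClass.LeftRotationInvariant Q Φ)
    (d₀ : ℝ) (hd₀ : d₀ < ((2 * min (N - r) r : ℕ) : ℝ) / 4)
    (hM : (M : ℤ) = ⌊2 * d₀ + (r : ℝ)⌋ + 1) :
    ∀ᵐ ω ∂P,
      (∀ i j, i ≠ j →
        GaussClass.dimGap (GaussClass.im (S i ω)) (GaussClass.im (S j ω)) =
          ((2 * min (N - r) r : ℕ) : ℤ)) ∧
      ∀ᵐ ω' ∂Q,
        ∀ c : ℝ → EuclideanSpace ℝ (Fin M) → Fin L,
          (∀ s, 0 < s → GaussClass.IsMAP p (fun i => S i ω) (Φ ω') s (c s)) →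
          ∃ ℓ : EReal, (d₀ : EReal) < ℓ ∧
            Tendsto
              (fun s : ℝ =>
                -ENNReal.log (GaussClass.errorProb p (fun i => S i ω) (Φ ω') s (c s)) /
                  ((Real.log (1 / s) : ℝ) : EReal))
              (𝓝[>] 0) (𝓝 ℓ) := by
  have hgen := GaussClass.ae_dimGap_eq hrN.le P (fun i ω => GaussClass.im (S i ω)) hrank hpdf hindep
  filter_upwards [hgen] with ω hω
  refine ⟨fun i j hij => (hω i j hij).2, ?_⟩
  -- This `R` is half of the dimension gap, so the hypothesis reads `2 d₀ < R`, whence `M ≤ r + R =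
  -- min N (2r)`.
  set R : ℕ := min (N - r) r with hR
  have hMub : (M : ℝ) < (r : ℝ) + R + 1 := by
    have h1 : ((M : ℤ) : ℝ) ≤ 2 * d₀ + r + 1 := by
      rw [hM]; push_cast; linarith [Int.floor_le (2 * d₀ + (r : ℝ))]
    push_cast at h1 hd₀
    linarith
  have hMub' : M ≤ r + R := by
    have : M < r + R + 1 := by exact_mod_cast hMub
    omega
  have hMlb : 2 * d₀ + r < M := by
    have h1 : ((M : ℤ) : ℝ) = ⌊2 * d₀ + (r : ℝ)⌋ + 1 := by rw [hM]; push_cast; ring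
    push_cast at h1
    linarith [Int.lt_floor_add_one (2 * d₀ + (r : ℝ))]
  -- Properties holding for Lebesgue-almost every matrix pass to `Φ`, whose law has a density. The
  -- exceptional set depends on `ω` but not on the noise level or the classifiers.
  have hΦac : ∀ {q : Matrix (Fin M) (Fin N) ℝ → Prop}, (∀ᵐ φ ∂GaussClass.matrixVolume M N, q φ) →
      ∀ᵐ ω' ∂Q, q (Φ ω') := by
    intro q hq
    have := hΦ.hasPDF
    exact ae_of_ae_map (HasPDF.aemeasurable Φ Q (GaussClass.matrixVolume M N))
      ((HasPDF.absolutelyContinuous (X := Φ)).ae_le hq)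
  have h1 : ∀ᵐ ω' ∂Q, ∀ i, (Φ ω' * S i ω * (Φ ω').transpose).rank = min M (S i ω).rank :=
    ae_all_iff.2 fun i => hΦac (GaussClass.ae_rank_compress M (hS i ω))
  have h2 : ∀ᵐ ω' ∂Q, ∀ i j, (Φ ω' * (S i ω + S j ω) * (Φ ω').transpose).rank =
      min M (S i ω + S j ω).rank :=
    ae_all_iff.2 fun i => ae_all_iff.2 fun j =>
      hΦac (GaussClass.ae_rank_compress M ((hS i ω).add (hS j ω)))
  filter_upwards [h1, h2] with ω' h1 h2 c hc
  -- The truncated difference is intended: when `M ≤ r` each compressed covariance already has full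
  -- rank `M`, and the exponent is `0`.
  obtain ⟨ℓ, hℓ, hlim⟩ := GaussClass.exists_tendsto_exponent (e := M - r) (fun i => hS i ω)
    (fun i => by
      rw [h1, ← GaussClass.finrank_im, hrank]
      omega)
    (fun i j hij => by
      have h3 := GaussClass.finrank_im_sup_le_rank_add (hS i ω) (hS j ω)
      have h4 := (hω i j hij).1
      rw [h2]
      omega) hc
  refine ⟨ℓ, lt_of_lt_of_le ?_ hℓ, hlim⟩
  -- Truncation only increases the difference, so `d₀ < (M - r) / 2` survives also when `M < r`,
  -- where `d₀` is negative.
  have h5 : (M : ℝ) - r ≤ ((M - r : ℕ) : ℝ) := by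
    rw [sub_le_iff_le_add]
    exact_mod_cast (by omega : M ≤ M - r + r)
  exact_mod_cast (by linarith : d₀ < ((M - r : ℕ) : ℝ) / 2)
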